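/- For integers $\ell, n \ge 3$ let $ES_\ell(n)$ be the minimum $N$ such that every set of $N$ points in the Euclidean plane contains $\ell$ collinear points or $n$ points in convex position (that is, $n$ points forming the vertex set of a convex $n$-gon; no point lies in the convex hull of the others). Then, for all integers $\ell, n \ge 3$, with the exception of the pairs with $n = 4$ and $\ell \ge 5$, $$ES_\ell(n) \ \ge\ (3\ell-1)\cdot 2^{\,n-5} + 1 .$$ -/

import Mathlib

open scoped ENNReal

/-- The Euclidean plane. -/
abbrev Plane : Type := EuclideanSpace ℝ (Fin 2)

/-- `P` contains `ℓ` collinear members. -/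
def HasCollinear (ℓ : ℕ) (P : Finset Plane) : Prop :=
  ∃ S ⊆ P, S.card = ℓ ∧ Collinear ℝ (S : Set Plane)

/-- `S` is in convex position: no point of `S` lies in the convex hull of the other points of `S`,
i.e. (for at least three points) `S` is the vertex set of a convex polygon. -/
def InConvexPosition (S : Finset Plane) : Prop :=
  ConvexIndependent ℝ (fun p : S => (p : Plane))

/-- `P` contains `n` points in convex position. -/
def HasConvexPosition (n : ℕ) (P : Finset Plane) : Prop :=
  ∃ S ⊆ P, S.card = n ∧ InConvexPosition S

/-- Every `N`-element point set in the plane contains either `ℓ` collinear members or `n` points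
in convex position. -/
def Forces (ℓ n N : ℕ) : Prop :=
  ∀ P : Finset Plane, P.card = N → HasCollinear ℓ P ∨ HasConvexPosition n P

/-- The minimum `N` such that every `N`-element point set in the plane contains either `ℓ`
collinear members or `n` points in convex position (it would be `⊤` if there were no such `N`). -/
noncomputable def ES (ℓ n : ℕ) : ℕ∞ :=
  ⨅ (N : ℕ) (_ : Forces ℓ n N), (N : ℕ∞)

/-! A point that is weakly below one chord of a set and weakly above another lies in the convex hull
of the other points. It therefore suffices to bound subsets with `NoSandwich`, a condition on
orientations alone. Such a subset is a strict cap and a strict cup sharing the leftmost point.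
Strictness is what lets `ℓ` enter: `ℓ - 1` points on a line contribute at most two to any cap or
cup.

For `n ≥ 6` the Erdős–Szekeres construction is run from better initial sets. If `X` is far to the
right of `Y` and much further below, a cup meeting both has one point in `Y` and a cap meeting both
has one point in `X`, so sizes add as in Pascal's triangle (`CupCapSize.join`). The initial row,
with caps at most `a`, cups at most `b` and `a + b = 6`, has sizes `1, 2ℓ-2, 2ℓ, 2ℓ-2, 1`, in total
`2(3ℓ-1)`; every further row doubles the total. The sets of the row `a + b = n` are then joined into
one: a convex polygon crossing a join is a cap on the left and a cup on the right
(`ConvexLE.union`), hence has fewer than `n` vertices.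

For `n = 3` a line suffices, for `n = 4` explicit points. For `n = 5`, three segments with `ℓ - 1`
points each and two single points are placed so that orientations depend only on the pieces
involved, which leaves a finite check (`pentaSandwich`). -/

/-- Twice the signed area of the triangle `a b c`. -/
noncomputable def orient (a b c : Plane) : ℝ :=
  (b 0 - a 0) * (c 1 - a 1) - (b 1 - a 1) * (c 0 - a 0)

/-- The points of `P` have distinct first coordinates. -/
def DistinctX (P : Finset Plane) : Prop := Set.InjOn (fun p : Plane => p 0) (P : Set Plane)

/-- A subset of `P` all of whose triples, read from left to right, have an orientation
satisfying `T`, has at most `k` points. -/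
def TripleLE (T : ℝ → Prop) (k : ℕ) (P : Finset Plane) : Prop :=
  ∀ S ⊆ P, (∀ a ∈ S, ∀ b ∈ S, ∀ c ∈ S, a 0 < b 0 → b 0 < c 0 → T (orient a b c)) → S.card ≤ k

/-- No point of `S` lies both weakly below a chord and weakly above a chord of `S` that pass
over or under it. -/
def NoSandwich (S : Finset Plane) : Prop :=
  ∀ u₁ ∈ S, ∀ u₂ ∈ S, ∀ v₁ ∈ S, ∀ v₂ ∈ S, ∀ q ∈ S, u₁ 0 < q 0 → q 0 < u₂ 0 → v₁ 0 < q 0 →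
    q 0 < v₂ 0 → 0 ≤ orient u₁ q u₂ → orient v₁ q v₂ ≤ 0 → False

/-- Every subset of `P` without a sandwiched point has at most `k` points. -/
def ConvexLE (k : ℕ) (P : Finset Plane) : Prop :=
  ∀ S ⊆ P, NoSandwich S → S.card ≤ k

/-! ### Convex position, caps and cups -/

theorem DistinctX.mono {P Q : Finset Plane} (h : DistinctX Q) (hPQ : P ⊆ Q) : DistinctX P :=
  Set.InjOn.mono (by exact_mod_cast hPQ) h

theorem tripleLE_card {T : ℝ → Prop} {k : ℕ} {P : Finset Plane} (h : P.card ≤ k) :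
    TripleLE T k P :=
  fun _ hS _ => (Finset.card_le_card hS).trans h

theorem exists_chord_point {u w q : Plane} (h₁ : u 0 < q 0) (h₂ : q 0 < w 0) (s : Set Plane)
    (hu : u ∈ s) (hw : w ∈ s) :
    ∃ a ∈ convexHull ℝ s, a 0 = q 0 ∧ (a 1 - q 1) * (w 0 - u 0) = orient u q w := by
  have hd : 0 < w 0 - u 0 := by linarith
  refine ⟨((w 0 - q 0) / (w 0 - u 0)) • u + ((q 0 - u 0) / (w 0 - u 0)) • w, ?_, ?_, ?_⟩
  · refine convex_convexHull ℝ s (subset_convexHull ℝ s hu) (subset_convexHull ℝ s hw)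
      (div_nonneg (by linarith) hd.le) (div_nonneg (by linarith) hd.le) ?_
    field_simp
    ring
  · simp only [PiLp.add_apply, PiLp.smul_apply, smul_eq_mul]
    field_simp
    ring
  · simp only [PiLp.add_apply, PiLp.smul_apply, smul_eq_mul, orient]
    field_simp
    ring

/-- The vertical line through a sandwiched `q` meets one chord at or above `q` and another at or
below it, so `q` is a convex combination of the two meeting points. -/
theorem InConvexPosition.noSandwich {S : Finset Plane} (h : InConvexPosition S) :
    NoSandwich S := by
  intro u₁ hu₁ u₂ hu₂ v₁ hv₁ v₂ hv₂ q hq h₁ h₂ h₃ h₄ hu hv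
  let t : Set S := {⟨u₁, hu₁⟩, ⟨u₂, hu₂⟩, ⟨v₁, hv₁⟩, ⟨v₂, hv₂⟩}
  have hqt : (⟨q, hq⟩ : S) ∉ t := by
    simp only [t, Set.mem_insert_iff, Set.mem_singleton_iff, Subtype.mk.injEq]
    rintro (rfl | rfl | rfl | rfl) <;> simp_all
  refine hqt ((ConvexIndependent.mem_convexHull_iff h t ⟨q, hq⟩).1 ?_)
  have hmem : ∀ x (hx : x ∈ S), (⟨x, hx⟩ : S) ∈ t → x ∈ (fun p : S => (p : Plane)) '' t :=
    fun x hx hxt => ⟨⟨x, hx⟩, hxt, rfl⟩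
  obtain ⟨a, ha, ha0, ha1⟩ := exists_chord_point h₁ h₂ _ (hmem u₁ hu₁ (by simp [t]))
    (hmem u₂ hu₂ (by simp [t]))
  obtain ⟨b, hb, hb0, hb1⟩ := exists_chord_point h₃ h₄ _ (hmem v₁ hv₁ (by simp [t]))
    (hmem v₂ hv₂ (by simp [t]))
  have ha2 : q 1 ≤ a 1 := by
    by_contra! hlt
    have := mul_neg_of_neg_of_pos (sub_neg.2 hlt) (show 0 < u₂ 0 - u₁ 0 by linarith)
    linarith
  have hb2 : b 1 ≤ q 1 := by
    by_contra! hlt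
    have := mul_pos (sub_pos.2 hlt) (show 0 < v₂ 0 - v₁ 0 by linarith)
    linarith
  rcases eq_or_lt_of_le ha2 with haq | haq
  · have : q = a := by
      ext i
      fin_cases i
      · exact ha0.symm
      · exact haq
    change q ∈ _
    rwa [this]
  · have hd : 0 < a 1 - b 1 := by linarith
    have : q = ((q 1 - b 1) / (a 1 - b 1)) • a + ((a 1 - q 1) / (a 1 - b 1)) • b := by
      ext i
      fin_cases i
      · simp only [Fin.zero_eta, PiLp.add_apply, PiLp.smul_apply, smul_eq_mul, ha0, hb0]
        field_simp
        ring
      · simp only [Fin.mk_one, PiLp.add_apply, PiLp.smul_apply, smul_eq_mul]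
        field_simp
        ring
    change q ∈ _
    rw [this]
    refine convex_convexHull ℝ _ ha hb (div_nonneg (by linarith) hd.le)
      (div_nonneg (by linarith) hd.le) ?_
    field_simp
    ring

theorem Collinear.orient_eq_zero {s : Set Plane} (h : Collinear ℝ s) {a b c : Plane}
    (ha : a ∈ s) (hb : b ∈ s) (hc : c ∈ s) : orient a b c = 0 := by
  obtain ⟨v, hv⟩ := (collinear_iff_of_mem ha).1 h
  obtain ⟨r, rfl⟩ := hv b hb
  obtain ⟨t, rfl⟩ := hv c hc
  simp [orient]
  ring

theorem not_hasCollinear {ℓ : ℕ} {P : Finset Plane} (hℓ : 0 < ℓ)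
    (h : TripleLE (· = 0) (ℓ - 1) P) : ¬ HasCollinear ℓ P := by
  rintro ⟨S, hS, hc, hcol⟩
  have := h S hS fun a ha b hb c hc _ _ => hcol.orient_eq_zero ha hb hc
  omega

theorem not_hasConvexPosition {n : ℕ} {P : Finset Plane} (hn : 0 < n)
    (h : ConvexLE (n - 1) P) : ¬ HasConvexPosition n P := by
  rintro ⟨S, hS, hc, hconv⟩
  have := h S hS hconv.noSandwich
  omega

theorem exists_sorted {S : Finset Plane} (hS : DistinctX S) {k : ℕ} (hk : k ≤ S.card) :
    ∃ s : Fin k → Plane, (∀ i, s i ∈ S) ∧ StrictMono fun i => s i 0 := by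
  obtain ⟨S', hS', hc⟩ := Finset.exists_subset_card_eq hk
  have hcard : (S'.image fun p : Plane => p 0).card = k := by
    rw [Finset.card_image_of_injOn (hS.mono hS'), hc]
  have hmem := fun i => Finset.mem_image.1 (Finset.orderEmbOfFin_mem _ hcard i)
  choose s hs hse using hmem
  exact ⟨s, fun i => hS' (hs i), fun i j hij => by
    simpa only [hse] using (Finset.orderEmbOfFin _ hcard).strictMono hij⟩

/-- A set in which no triple is allowed has at most two points. -/
theorem card_le_two_of_forall_triple {S : Finset Plane} (hS : DistinctX S)
    (h : ∀ a ∈ S, ∀ b ∈ S, ∀ c ∈ S, a 0 < b 0 → b 0 < c 0 → False) : S.card ≤ 2 := by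
  by_contra! hc
  obtain ⟨s, hs, hm⟩ := exists_sorted hS hc
  exact h _ (hs 0) _ (hs 1) _ (hs 2) (hm (by decide)) (hm (by decide))

/-- A set without sandwiched points is the union of a cap and a cup with a common point. -/
theorem NoSandwich.card_lt {S P : Finset Plane} {a b : ℕ} (h : NoSandwich S) (hSP : S ⊆ P)
    (hne : S.Nonempty) (hcap : TripleLE (· < 0) a P)
    (hcup : TripleLE (0 < ·) b P) : S.card < a + b := by
  classical
  set U := S.filter fun q => ¬ ∃ u ∈ S, ∃ w ∈ S, u 0 < q 0 ∧ q 0 < w 0 ∧ 0 ≤ orient u q w with hU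
  set V := S.filter fun q => ¬ ∃ u ∈ S, ∃ w ∈ S, u 0 < q 0 ∧ q 0 < w 0 ∧ orient u q w ≤ 0 with hV
  -- `U` holds the points not weakly below any chord, `V` those not weakly above any; no chord
  -- passes over or under the leftmost point, so it belongs to both.
  have hUS : U ⊆ S := Finset.filter_subset _ _
  have hVS : V ⊆ S := Finset.filter_subset _ _
  have hUa : U.card ≤ a := hcap U (hUS.trans hSP) fun p hp q hq r hr h₁ h₂ => by
    by_contra! hle
    exact (Finset.mem_filter.1 hq).2 ⟨p, hUS hp, r, hUS hr, h₁, h₂, hle⟩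
  have hVb : V.card ≤ b := hcup V (hVS.trans hSP) fun p hp q hq r hr h₁ h₂ => by
    by_contra! hle
    exact (Finset.mem_filter.1 hq).2 ⟨p, hVS hp, r, hVS hr, h₁, h₂, hle⟩
  have hunion : S ⊆ U ∪ V := by
    intro q hq
    by_contra hn
    rw [Finset.mem_union, not_or] at hn
    simp only [hU, hV, Finset.mem_filter, hq, true_and, not_not] at hn
    obtain ⟨⟨u₁, hu₁, u₂, hu₂, h₁, h₂, hu⟩, ⟨v₁, hv₁, v₂, hv₂, h₃, h₄, hv⟩⟩ := hn
    exact h u₁ hu₁ u₂ hu₂ v₁ hv₁ v₂ hv₂ q hq h₁ h₂ h₃ h₄ hu hv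
  obtain ⟨m, hm, hmin⟩ := S.exists_min_image (fun p => p 0) hne
  have hinter : 0 < (U ∩ V).card := by
    refine Finset.card_pos.2 ⟨m, Finset.mem_inter.2 ⟨?_, ?_⟩⟩ <;>
    · refine Finset.mem_filter.2 ⟨hm, ?_⟩
      rintro ⟨u, hu, -, -, hlt, -⟩
      exact absurd (hmin u hu) (not_le.2 hlt)
  have := Finset.card_union_add_card_inter U V
  have := Finset.card_le_card hunion
  omega

/-- A point set without `ℓ` collinear points and without convex `n`-gons bounds `ES ℓ n`. -/
theorem lt_ES {ℓ n : ℕ} (P : Finset Plane) (hcol : ¬ HasCollinear ℓ P)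
    (hconv : ¬ HasConvexPosition n P) : ((P.card + 1 : ℕ) : ℕ∞) ≤ ES ℓ n := by
  refine le_iInf₂ fun N hN => ?_
  by_contra! hlt
  have hle : N ≤ P.card := by
    have : N < P.card + 1 := by exact_mod_cast hlt
    omega
  obtain ⟨Q, hQ, hc⟩ := Finset.exists_subset_card_eq hle
  rcases hN Q hc with ⟨S, hS, h⟩ | ⟨S, hS, h⟩
  · exact hcol ⟨S, hS.trans hQ, h⟩
  · exact hconv ⟨S, hS.trans hQ, h⟩

/-! ### Joining two distant sets -/

/-- `X` lies to the right of `Y`, below all lines spanned by `Y`, and `Y` lies above all lines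
spanned by `X`. -/
structure RightBelow (Y X : Finset Plane) : Prop where
  lt : ∀ y ∈ Y, ∀ x ∈ X, y 0 < x 0
  neg : ∀ y ∈ Y, ∀ z ∈ Y, ∀ x ∈ X, y 0 < z 0 → orient y z x < 0
  pos : ∀ y ∈ Y, ∀ x ∈ X, ∀ z ∈ X, x 0 < z 0 → 0 < orient y x z

/-- The translate of `P` by `v`. -/
noncomputable def planeShift (v : Plane) (P : Finset Plane) : Finset Plane :=
  P.map (addRightEmbedding v)

theorem mem_shift {v p : Plane} {P : Finset Plane} :
    p ∈ planeShift v P ↔ ∃ q ∈ P, q + v = p := by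
  simp [planeShift]

@[simp] theorem orient_add (v a b c : Plane) : orient (a + v) (b + v) (c + v) = orient a b c := by
  simp [orient]

theorem card_shift (v : Plane) (P : Finset Plane) : (planeShift v P).card = P.card :=
  Finset.card_map _

theorem DistinctX.shift {P : Finset Plane} (h : DistinctX P) (v : Plane) :
    DistinctX (planeShift v P) := by
  intro a ha b hb hab
  obtain ⟨a, ha', rfl⟩ := mem_shift.1 (Finset.mem_coe.1 ha)
  obtain ⟨b, hb', rfl⟩ := mem_shift.1 (Finset.mem_coe.1 hb)
  exact congrArg (· + v) (h ha' hb' (by simpa using hab))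

theorem TripleLE.shift {T : ℝ → Prop} {k : ℕ} {P : Finset Plane} (h : TripleLE T k P)
    (v : Plane) : TripleLE T k (planeShift v P) := by
  intro S hS hT
  obtain ⟨S, hS', rfl⟩ := Finset.subset_map_iff.1 hS
  rw [Finset.card_map]
  refine h S hS' fun a ha b hb c hc hab hbc => ?_
  have := hT (a + v) (Finset.mem_map_of_mem _ ha) (b + v) (Finset.mem_map_of_mem _ hb) (c + v)
    (Finset.mem_map_of_mem _ hc) (by simpa using hab) (by simpa using hbc)
  simpa using this

open Filter in
-- The horizontal shift `a` is fixed first. Each orientation is then affine in the downward shift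
-- `b`, with slope of the required sign, so all conditions hold for large `b`.
theorem exists_rightBelow_shift (Y X : Finset Plane) :
    ∃ v, RightBelow Y (planeShift v X) := by
  have hlin : ∀ c d : ℝ, 0 < d → ∀ᶠ t in atTop, 0 < d * t + c := fun c d hd =>
    (tendsto_atTop_add_const_right _ c (tendsto_id.const_mul_atTop hd)).eventually_gt_atTop 0
  obtain ⟨a, ha⟩ : ∃ a : ℝ, ∀ y ∈ Y, ∀ x ∈ X, 0 < 1 * a + (x 0 - y 0) :=
    (((Finset.eventually_all Y).2 fun y _ => (Finset.eventually_all X).2 fun x _ =>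
      hlin (x 0 - y 0) 1 one_pos) : ∀ᶠ a in atTop, _).exists
  obtain ⟨b, hb₁, hb₂⟩ : ∃ b : ℝ,
      (∀ y ∈ Y, ∀ z ∈ Y, ∀ x ∈ X, y 0 < z 0 → orient y z (x + !₂[a, -b]) < 0) ∧
      (∀ y ∈ Y, ∀ x ∈ X, ∀ z ∈ X, x 0 < z 0 →
        0 < orient y (x + !₂[a, -b]) (z + !₂[a, -b])) := by
    refine Eventually.exists (f := atTop) (Eventually.and ?_ ?_)
    · refine (Finset.eventually_all Y).2 fun y _ => (Finset.eventually_all Y).2 fun z _ =>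
        (Finset.eventually_all X).2 fun x _ => ?_
      by_cases h : y 0 < z 0
      · filter_upwards [hlin (-orient y z (x + !₂[a, 0])) (z 0 - y 0) (sub_pos.2 h)] with b hb _
        simp [orient] at hb ⊢
        linarith
      · exact Eventually.of_forall fun _ h' => absurd h' h
    · refine (Finset.eventually_all Y).2 fun y _ => (Finset.eventually_all X).2 fun x _ =>
        (Finset.eventually_all X).2 fun z _ => ?_
      by_cases h : x 0 < z 0
      · filter_upwards [hlin (orient y (x + !₂[a, 0]) (z + !₂[a, 0])) (z 0 - x 0)
          (sub_pos.2 h)] with b hb _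
        simp [orient] at hb ⊢
        linarith
      · exact Eventually.of_forall fun _ h' => absurd h' h
  refine ⟨!₂[a, -b], ?_, ?_, ?_⟩
  · intro y hy x hx
    obtain ⟨x, hx', rfl⟩ := mem_shift.1 hx
    have := ha y hy x hx'
    simp
    linarith
  · intro y hy z hz x hx h
    obtain ⟨x, hx', rfl⟩ := mem_shift.1 hx
    exact hb₁ y hy z hz x hx' h
  · intro y hy x hx z hz h
    obtain ⟨x, hx', rfl⟩ := mem_shift.1 hx
    obtain ⟨z, hz', rfl⟩ := mem_shift.1 hz
    exact hb₂ y hy x hx' z hz' (by simpa using h)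

section Join

open scoped Classical

variable {Y X : Finset Plane}

theorem DistinctX.union (hY : DistinctX Y) (hX : DistinctX X)
    (h : ∀ y ∈ Y, ∀ x ∈ X, y 0 < x 0) : DistinctX (Y ∪ X) := by
  intro a ha b hb hab
  rcases Finset.mem_union.1 (Finset.mem_coe.1 ha) with ha | ha <;>
    rcases Finset.mem_union.1 (Finset.mem_coe.1 hb) with hb | hb
  · exact hY ha hb hab
  · exact absurd hab (h a ha b hb).ne
  · exact absurd hab (h b hb a ha).ne'
  · exact hX ha hb hab

theorem card_union_of_lt (h : ∀ y ∈ Y, ∀ x ∈ X, y 0 < x 0) :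
    (Y ∪ X).card = Y.card + X.card :=
  Finset.card_union_of_disjoint
    (Finset.disjoint_left.2 fun p hp hp' => lt_irrefl _ (h p hp p hp'))

theorem card_inter_le_one_of_pairs {S : Finset Plane} (hY : DistinctX Y)
    (h : ∀ a ∈ S, a ∈ Y → ∀ b ∈ S, b ∈ Y → a 0 < b 0 → False) : (S ∩ Y).card ≤ 1 := by
  refine Finset.card_le_one.2 fun a ha b hb => ?_
  rw [Finset.mem_inter] at ha hb
  rcases lt_trichotomy (a 0) (b 0) with hab | hab | hab
  · exact (h a ha.1 ha.2 b hb.1 hb.2 hab).elim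
  · exact hY ha.2 hb.2 hab
  · exact (h b hb.1 hb.2 a ha.1 ha.2 hab).elim

/-- A subset of `Y ∪ X` lies in `Y`, lies in `X`, or meets both parts. -/
theorem subset_union_cases {S : Finset Plane} (hS : S ⊆ Y ∪ X) :
    S ⊆ Y ∨ S ⊆ X ∨ (∃ y ∈ S, y ∈ Y) ∧ (∃ x ∈ S, x ∈ X) ∧
      S.card ≤ (S ∩ Y).card + (S ∩ X).card := by
  by_cases h₁ : ∃ y ∈ S, y ∈ Y
  · by_cases h₂ : ∃ x ∈ S, x ∈ X
    · refine Or.inr (Or.inr ⟨h₁, h₂, ?_⟩)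
      rw [← Finset.inter_eq_left.2 hS, Finset.inter_union_distrib_left]
      refine (Finset.card_union_le _ _).trans ?_
      rw [← Finset.inter_union_distrib_left, Finset.inter_eq_left.2 hS]
    · refine Or.inl fun p hp => ?_
      exact (Finset.mem_union.1 (hS hp)).resolve_right fun h => h₂ ⟨p, hp, h⟩
  · refine Or.inr (Or.inl fun p hp => ?_)
    exact (Finset.mem_union.1 (hS hp)).resolve_left fun h => h₁ ⟨p, hp, h⟩

theorem TripleLE.inter {T : ℝ → Prop} {k : ℕ} {S : Finset Plane} (h : TripleLE T k X)
    (hT : ∀ a ∈ S, ∀ b ∈ S, ∀ c ∈ S, a 0 < b 0 → b 0 < c 0 → T (orient a b c)) :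
    (S ∩ X).card ≤ k :=
  h _ Finset.inter_subset_right fun a ha b hb c hc =>
    hT a (Finset.mem_inter.1 ha).1 b (Finset.mem_inter.1 hb).1 c (Finset.mem_inter.1 hc).1

/-- Two points of `Y` followed by one of `X` form a forbidden triple, so a subset meeting both parts
has one point in `Y` and at most `k` in `X`. -/
theorem TripleLE.union_of_left {T : ℝ → Prop} {k : ℕ} (hY : TripleLE T (k + 1) Y)
    (hX : TripleLE T k X) (hYx : DistinctX Y) (hlt : ∀ y ∈ Y, ∀ x ∈ X, y 0 < x 0)
    (h : ∀ y ∈ Y, ∀ z ∈ Y, ∀ x ∈ X, y 0 < z 0 → ¬ T (orient y z x)) :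
    TripleLE T (k + 1) (Y ∪ X) := by
  intro S hS hT
  rcases subset_union_cases hS with hSY | hSX | ⟨-, ⟨x, hxS, hxX⟩, hc⟩
  · exact hY S hSY hT
  · exact (hX S hSX hT).trans (Nat.le_succ k)
  · have := hX.inter hT
    have := card_inter_le_one_of_pairs (S := S) hYx fun a ha haY b hb hbY hab =>
      h a haY b hbY x hxX hab (hT a ha b hb x hxS hab (hlt b hbY x hxX))
    omega

theorem TripleLE.union_of_right {T : ℝ → Prop} {k : ℕ} (hY : TripleLE T k Y)
    (hX : TripleLE T (k + 1) X) (hXx : DistinctX X) (hlt : ∀ y ∈ Y, ∀ x ∈ X, y 0 < x 0)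
    (h : ∀ y ∈ Y, ∀ x ∈ X, ∀ z ∈ X, x 0 < z 0 → ¬ T (orient y x z)) :
    TripleLE T (k + 1) (Y ∪ X) := by
  intro S hS hT
  rcases subset_union_cases hS with hSY | hSX | ⟨⟨y, hyS, hyY⟩, -, hc⟩
  · exact (hY S hSY hT).trans (Nat.le_succ k)
  · exact hX S hSX hT
  · have := hY.inter hT
    have := card_inter_le_one_of_pairs (S := S) hXx fun a ha haX b hb hbX hab =>
      h y hyY a haX b hbX hab (hT y hyS a ha b hb (hlt y hyY a haX) hab)
    omega

theorem TripleLE.union_of_left_right {T : ℝ → Prop} {k : ℕ} (hk : 2 ≤ k) (hY : TripleLE T k Y)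
    (hX : TripleLE T k X) (hYx : DistinctX Y) (hXx : DistinctX X)
    (hlt : ∀ y ∈ Y, ∀ x ∈ X, y 0 < x 0)
    (h : ∀ y ∈ Y, ∀ z ∈ Y, ∀ x ∈ X, y 0 < z 0 → ¬ T (orient y z x))
    (h' : ∀ y ∈ Y, ∀ x ∈ X, ∀ z ∈ X, x 0 < z 0 → ¬ T (orient y x z)) :
    TripleLE T k (Y ∪ X) := by
  intro S hS hT
  rcases subset_union_cases hS with hSY | hSX | ⟨⟨y, hyS, hyY⟩, ⟨x, hxS, hxX⟩, hc⟩
  · exact hY S hSY hT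
  · exact hX S hSX hT
  · have := card_inter_le_one_of_pairs (S := S) hYx fun a ha haY b hb hbY hab =>
      h a haY b hbY x hxX hab (hT a ha b hb x hxS hab (hlt b hbY x hxX))
    have := card_inter_le_one_of_pairs (S := S) hXx fun a ha haX b hb hbX hab =>
      h' y hyY a haX b hbX hab (hT y hyS a ha b hb (hlt y hyY a haX) hab)
    omega

/-- A sandwich-free set meeting both parts of a `RightBelow` pair consists of a cap and a cup. -/
theorem ConvexLE.union {a b k : ℕ} (h : RightBelow Y X) (hY : ConvexLE k Y)
    (hX : ConvexLE k X) (hcap : TripleLE (· < 0) a Y) (hcup : TripleLE (0 < ·) b X)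
    (hk : a + b ≤ k) : ConvexLE k (Y ∪ X) := by
  intro S hS hT
  rcases subset_union_cases hS with hSY | hSX | ⟨⟨y, hyS, hyY⟩, ⟨x, hxS, hxX⟩, hc⟩
  · exact hY S hSY hT
  · exact hX S hSX hT
  · have h₁ : (S ∩ Y).card ≤ a := by
      refine hcap _ Finset.inter_subset_right fun p hp q hq r hr hpq hqr => ?_
      rw [Finset.mem_inter] at hp hq hr
      by_contra! hle
      -- The chord from `p` to `x` passes under `q`, so the chord from `p` to `r` must not pass over
      -- it.
      exact hT p hp.1 r hr.1 p hp.1 x hxS q hq.1 hpq hqr hpq (h.lt q hq.2 x hxX) hle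
        (h.neg p hp.2 q hq.2 x hxX hpq).le
    have h₂ : (S ∩ X).card ≤ b := by
      refine hcup _ Finset.inter_subset_right fun p hp q hq r hr hpq hqr => ?_
      rw [Finset.mem_inter] at hp hq hr
      by_contra! hle
      -- The chord from `y` to `r` passes over `q`, so the chord from `p` to `r` must not pass under
      -- it.
      exact hT y hyS r hr.1 p hp.1 r hr.1 q hq.1 (h.lt y hyY q hq.2) hqr hpq hqr
        (h.pos y hyY q hq.2 r hr.2 hqr).le hle
    omega

end Join

/-! ### Sets with bounded caps and cups -/

/-- A set with distinct first coordinates, fewer than `ℓ` points on a line, caps of at most `a`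
points and cups of at most `b` points. -/
structure CupCapFree (ℓ a b : ℕ) (P : Finset Plane) : Prop where
  distinctX : DistinctX P
  collinear : TripleLE (· = 0) (ℓ - 1) P
  cap : TripleLE (· < 0) a P
  cup : TripleLE (0 < ·) b P

/-- There is an `N`-point set that is `CupCapFree ℓ a b`. -/
def CupCapSize (ℓ a b N : ℕ) : Prop :=
  ∃ P : Finset Plane, P.card = N ∧ CupCapFree ℓ a b P

theorem cupCapSize_one {ℓ a b : ℕ} (hℓ : 3 ≤ ℓ) (ha : 1 ≤ a) (hb : 1 ≤ b) :
    CupCapSize ℓ a b 1 := by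
  refine ⟨{0}, by simp, by simp [DistinctX], ?_, ?_, ?_⟩ <;>
  · refine tripleLE_card ?_
    simp
    omega

open scoped Classical in
-- The Pascal recursion: only a cap can gain a point when extended from `Y` into `X`, and only a cup
-- when extended from `X` back into `Y`.
theorem CupCapSize.join {ℓ a b M N : ℕ} (hℓ : 3 ≤ ℓ) (hM : CupCapSize ℓ a (b + 1) M)
    (hN : CupCapSize ℓ (a + 1) b N) : CupCapSize ℓ (a + 1) (b + 1) (M + N) := by
  obtain ⟨Y, rfl, hY⟩ := hM
  obtain ⟨X, rfl, hX⟩ := hN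
  obtain ⟨v, hv⟩ := exists_rightBelow_shift Y X
  have hXx := hX.distinctX.shift v
  refine ⟨Y ∪ planeShift v X, by rw [card_union_of_lt hv.lt, card_shift],
    hY.distinctX.union hXx hv.lt, ?_, ?_, ?_⟩
  · exact .union_of_left_right (by omega) hY.collinear (hX.collinear.shift v) hY.distinctX
      hXx hv.lt (fun y hy z hz x hx h => (hv.neg y hy z hz x hx h).ne)
      fun y hy x hx z hz h => (hv.pos y hy x hx z hz h).ne'
  · exact .union_of_right hY.cap (hX.cap.shift v) hXx hv.lt
      fun y hy x hx z hz h => (hv.pos y hy x hx z hz h).le.not_gt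
  · exact .union_of_left hY.cup (hX.cup.shift v) hY.distinctX hv.lt
      fun y hy z hz x hx h => (hv.neg y hy z hz x hx h).le.not_gt

/-! ### Lines and wedges -/

/-- The points `(i, s * |i|)` with `i ∈ I`. -/
noncomputable def wedge (s : ℝ) (I : Finset ℤ) : Finset Plane :=
  I.map ⟨fun i : ℤ => !₂[(i : ℝ), s * |(i : ℝ)|], fun i j h => by
    simpa using congrArg (fun p : Plane => p 0) h⟩

theorem mem_wedge {s : ℝ} {I : Finset ℤ} {p : Plane} :
    p ∈ wedge s I ↔ ∃ i ∈ I, !₂[(i : ℝ), s * |(i : ℝ)|] = p :=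
  Finset.mem_map

theorem card_wedge (s : ℝ) (I : Finset ℤ) : (wedge s I).card = I.card :=
  Finset.card_map _

theorem distinctX_wedge (s : ℝ) (I : Finset ℤ) : DistinctX (wedge s I) := by
  intro a ha b hb hab
  obtain ⟨i, hi, rfl⟩ := mem_wedge.1 (Finset.mem_coe.1 ha)
  obtain ⟨j, hj, rfl⟩ := mem_wedge.1 (Finset.mem_coe.1 hb)
  have : (i : ℝ) = j := by simpa using hab
  rw [this]

theorem orient_wedge (s x y z : ℝ) :
    orient !₂[x, s * |x|] !₂[y, s * |y|] !₂[z, s * |z|] =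
      s * ((y - x) * (|z| - |x|) - (|y| - |x|) * (z - x)) := by
  simp [orient]
  ring

theorem orient_abs_nonneg {x y z : ℝ} (hxy : x < y) (hyz : y < z) :
    0 ≤ (y - x) * (|z| - |x|) - (|y| - |x|) * (z - x) := by
  rcases le_total 0 y with hy | hy
  · rw [abs_of_nonneg hy, abs_of_nonneg (hy.trans hyz.le)]
    nlinarith [neg_abs_le x, le_abs_self x]
  · rw [abs_of_nonpos hy, abs_of_nonpos (hxy.le.trans hy)]
    nlinarith [neg_abs_le z, le_abs_self z]

theorem tripleLE_two {T : ℝ → Prop} {P : Finset Plane} (hP : DistinctX P)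
    (h : ∀ a ∈ P, ∀ b ∈ P, ∀ c ∈ P, a 0 < b 0 → b 0 < c 0 → ¬ T (orient a b c)) :
    TripleLE T 2 P := fun _ hS hT =>
  card_le_two_of_forall_triple (hP.mono hS) fun a ha b hb c hc hab hbc =>
    h a (hS ha) b (hS hb) c (hS hc) hab hbc (hT a ha b hb c hc hab hbc)

open scoped Classical in
theorem wedge_union (s : ℝ) (I J : Finset ℤ) : wedge s (I ∪ J) = wedge s I ∪ wedge s J :=
  Finset.map_union _ _

/-- Each side of a wedge is collinear. -/
theorem orient_wedge_eq_zero {s : ℝ} {I : Finset ℤ}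
    (hI : (∀ i ∈ I, 0 < i) ∨ ∀ i ∈ I, i < 0) : ∀ a ∈ wedge s I, ∀ b ∈ wedge s I,
    ∀ c ∈ wedge s I, orient a b c = 0 := by
  intro a ha b hb c hc
  obtain ⟨i, hi, rfl⟩ := mem_wedge.1 ha
  obtain ⟨j, hj, rfl⟩ := mem_wedge.1 hb
  obtain ⟨k, hk, rfl⟩ := mem_wedge.1 hc
  rw [orient_wedge]
  rcases hI with h | h
  · have hpos : ∀ i ∈ I, |(i : ℝ)| = i := fun i hi => abs_of_pos (by exact_mod_cast h i hi)
    rw [hpos i hi, hpos j hj, hpos k hk]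
    ring
  · have hneg : ∀ i ∈ I, |(i : ℝ)| = -i := fun i hi => abs_of_neg (by exact_mod_cast h i hi)
    rw [hneg i hi, hneg j hj, hneg k hk]
    ring

theorem wedge_tripleLE_two {s : ℝ} {I : Finset ℤ} {T : ℝ → Prop} (hT : ¬ T 0)
    (hI : (∀ i ∈ I, 0 < i) ∨ ∀ i ∈ I, i < 0) : TripleLE T 2 (wedge s I) :=
  tripleLE_two (distinctX_wedge s I) fun a ha b hb c hc _ _ => by
    rwa [orient_wedge_eq_zero hI a ha b hb c hc]

theorem cupCapSize_line {ℓ : ℕ} : CupCapSize ℓ 2 2 (ℓ - 1) := by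
  have hI : (∀ i ∈ Finset.Ico (1 : ℤ) ℓ, 0 < i) ∨ ∀ i ∈ Finset.Ico (1 : ℤ) ℓ, i < 0 :=
    Or.inl fun i hi => by rw [Finset.mem_Ico] at hi; omega
  have hc : (wedge 1 (Finset.Ico (1 : ℤ) ℓ)).card = ℓ - 1 := by
    rw [card_wedge, Int.card_Ico]
    omega
  exact ⟨_, hc, distinctX_wedge _ _, tripleLE_card hc.le,
    wedge_tripleLE_two (lt_irrefl _) hI, wedge_tripleLE_two (lt_irrefl _) hI⟩

open scoped Classical in
theorem TripleLE.union {T : ℝ → Prop} {k m : ℕ} {Y X : Finset Plane} (hY : TripleLE T k Y)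
    (hX : TripleLE T m X) : TripleLE T (k + m) (Y ∪ X) := by
  intro S hS hT
  rcases subset_union_cases hS with h | h | ⟨-, -, hc⟩
  · exact (hY S h hT).trans (Nat.le_add_right k m)
  · exact (hX S h hT).trans (Nat.le_add_left m k)
  · have := hY.inter hT
    have := hX.inter hT
    omega

open scoped Classical in
-- Each side carries `ℓ - 1` collinear points and gives at most two to a strict cap or cup. The apex
-- is omitted because it lies on the lines of both sides. The sign of `s` decides whether caps or
-- cups are excluded.
theorem exists_wedge {ℓ : ℕ} (hℓ : 3 ≤ ℓ) {s : ℝ} (hs : s ≠ 0) : ∃ P : Finset Plane,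
    P.card = 2 * ℓ - 2 ∧ DistinctX P ∧ TripleLE (· = 0) (ℓ - 1) P ∧
    (∀ T : ℝ → Prop, ¬ T 0 → TripleLE T 4 P) ∧
    ∀ a ∈ P, ∀ b ∈ P, ∀ c ∈ P, a 0 < b 0 → b 0 < c 0 → ∃ r, 0 ≤ r ∧ orient a b c = s * r := by
  set I := Finset.Ioo (-ℓ : ℤ) 0 with hI
  set J := Finset.Ioo (0 : ℤ) ℓ with hJ
  have hIn : ∀ i ∈ I, i < 0 := fun i hi => (Finset.mem_Ioo.1 hi).2
  have hJp : ∀ i ∈ J, 0 < i := fun i hi => (Finset.mem_Ioo.1 hi).1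
  have hcI : (wedge s I).card = ℓ - 1 := by
    rw [card_wedge, hI, Int.card_Ioo]
    omega
  have hcJ : (wedge s J).card = ℓ - 1 := by
    rw [card_wedge, hJ, Int.card_Ioo]
    omega
  have hlt : ∀ y ∈ wedge s I, ∀ x ∈ wedge s J, y 0 < x 0 := by
    intro y hy x hx
    obtain ⟨i, hi, rfl⟩ := mem_wedge.1 hy
    obtain ⟨j, hj, rfl⟩ := mem_wedge.1 hx
    have := (hIn i hi).trans (hJp j hj)
    simpa using this
  refine ⟨wedge s (I ∪ J), ?_, distinctX_wedge _ _, ?_, fun T hT => ?_, ?_⟩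
  · rw [wedge_union, card_union_of_lt hlt]
    omega
  · rw [wedge_union]
    refine .union_of_left_right (by omega) (tripleLE_card hcI.le) (tripleLE_card hcJ.le)
      (distinctX_wedge _ _) (distinctX_wedge _ _) hlt ?_ ?_
    · intro y hy z hz x hx h
      obtain ⟨i, hi, rfl⟩ := mem_wedge.1 hy
      obtain ⟨j, hj, rfl⟩ := mem_wedge.1 hz
      obtain ⟨k, hk, rfl⟩ := mem_wedge.1 hx
      have h1 : (i : ℝ) < 0 := by exact_mod_cast hIn i hi
      have h2 : (j : ℝ) < 0 := by exact_mod_cast hIn j hj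
      have h3 : (0 : ℝ) < k := by exact_mod_cast hJp k hk
      have h4 : (i : ℝ) < j := by simpa using h
      rw [orient_wedge, abs_of_neg h1, abs_of_neg h2, abs_of_pos h3]
      refine mul_ne_zero hs (ne_of_gt ?_)
      nlinarith
    · intro y hy z hz x hx h
      obtain ⟨i, hi, rfl⟩ := mem_wedge.1 hy
      obtain ⟨j, hj, rfl⟩ := mem_wedge.1 hz
      obtain ⟨k, hk, rfl⟩ := mem_wedge.1 hx
      have h1 : (i : ℝ) < 0 := by exact_mod_cast hIn i hi
      have h2 : (0 : ℝ) < j := by exact_mod_cast hJp j hj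
      have h3 : (0 : ℝ) < k := by exact_mod_cast hJp k hk
      have h4 : (j : ℝ) < k := by simpa using h
      rw [orient_wedge, abs_of_neg h1, abs_of_pos h2, abs_of_pos h3]
      refine mul_ne_zero hs (ne_of_gt ?_)
      nlinarith
  · rw [wedge_union]
    exact (wedge_tripleLE_two hT (Or.inr hIn)).union (wedge_tripleLE_two hT (Or.inl hJp))
  · intro a ha b hb c hc hab hbc
    obtain ⟨i, hi, rfl⟩ := mem_wedge.1 ha
    obtain ⟨j, hj, rfl⟩ := mem_wedge.1 hb
    obtain ⟨k, hk, rfl⟩ := mem_wedge.1 hc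
    exact ⟨_, orient_abs_nonneg (by simpa using hab) (by simpa using hbc), orient_wedge _ _ _ _⟩

theorem cupCapSize_two_four {ℓ : ℕ} (hℓ : 3 ≤ ℓ) : CupCapSize ℓ 2 4 (2 * ℓ - 2) := by
  obtain ⟨P, hc, hx, hcol, h4, hs⟩ := exists_wedge hℓ (one_ne_zero (α := ℝ))
  refine ⟨P, hc, hx, hcol, tripleLE_two hx fun a ha b hb c hc hab hbc => ?_, h4 _ (lt_irrefl _)⟩
  obtain ⟨r, hr, h⟩ := hs a ha b hb c hc hab hbc
  linarith

theorem cupCapSize_four_two {ℓ : ℕ} (hℓ : 3 ≤ ℓ) : CupCapSize ℓ 4 2 (2 * ℓ - 2) := by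
  obtain ⟨P, hc, hx, hcol, h4, hs⟩ := exists_wedge hℓ (neg_ne_zero.2 (one_ne_zero (α := ℝ)))
  refine ⟨P, hc, hx, hcol, h4 _ (lt_irrefl _), tripleLE_two hx fun a ha b hb c hc hab hbc => ?_⟩
  obtain ⟨r, hr, h⟩ := hs a ha b hb c hc hab hbc
  linarith

/-! ### Rows of sizes and the case `n ≥ 6` -/

/-- Sizes of the sets obtained by repeated joins from five initial ones. -/
def joinSize (ℓ : ℕ) : ℕ → ℕ → ℕ
  | 0, 0 => 1
  | 0, 1 => 2 * ℓ - 2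
  | 0, 2 => 2 * ℓ
  | 0, 3 => 2 * ℓ - 2
  | 0, 4 => 1
  -- Zero beyond the end of the row lets the same recursion produce the last entry of the next row.
  | 0, _ + 5 => 0
  | k + 1, 0 => joinSize ℓ k 0
  | k + 1, j + 1 => joinSize ℓ k j + joinSize ℓ k (j + 1)

theorem joinSize_zero_right (ℓ k : ℕ) : joinSize ℓ k 0 = 1 := by
  induction k with
  | zero => rfl
  | succ k ih => exact ih

theorem joinSize_eq_zero (ℓ k : ℕ) : ∀ j, 4 + k < j → joinSize ℓ k j = 0 := by
  induction k with
  | zero =>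
    intro j hj
    obtain ⟨j, rfl⟩ := Nat.exists_eq_add_of_le' (show 5 ≤ j by omega)
    rfl
  | succ k ih =>
    rintro (_ | j) hj
    · omega
    · rw [joinSize, ih j (by omega), ih (j + 1) (by omega)]

theorem joinSize_last (ℓ k : ℕ) : joinSize ℓ k (4 + k) = 1 := by
  induction k with
  | zero => rfl
  | succ k ih =>
    rw [← Nat.add_assoc, joinSize, ih, joinSize_eq_zero ℓ k _ (by omega)]

theorem sum_joinSize {ℓ : ℕ} (hℓ : 3 ≤ ℓ) (k : ℕ) :
    ∑ j ∈ Finset.range (5 + k), joinSize ℓ k j = (6 * ℓ - 2) * 2 ^ k := by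
  induction k with
  | zero =>
    simp [Finset.sum_range_succ, joinSize]
    omega
  | succ k ih =>
    rw [← Nat.add_assoc, Finset.sum_range_succ']
    simp only [joinSize, Finset.sum_add_distrib]
    rw [Nat.add_assoc, ← Finset.sum_range_succ' (joinSize ℓ k), Finset.sum_range_succ, ih,
      joinSize_eq_zero ℓ k (5 + k) (by omega), pow_succ]
    ring

theorem cupCapSize_joinSize {ℓ : ℕ} (hℓ : 3 ≤ ℓ) (k : ℕ) :
    ∀ i j, i + j = 4 + k → CupCapSize ℓ (j + 1) (i + 1) (joinSize ℓ k j) := by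
  induction k with
  | zero =>
    have h23 : CupCapSize ℓ 2 3 (1 + (ℓ - 1)) :=
      .join hℓ (cupCapSize_one hℓ le_rfl (by norm_num)) cupCapSize_line
    have h32 : CupCapSize ℓ 3 2 (ℓ - 1 + 1) :=
      .join hℓ cupCapSize_line (cupCapSize_one hℓ (by norm_num) le_rfl)
    intro i j hij
    obtain ⟨rfl, rfl⟩ | ⟨rfl, rfl⟩ | ⟨rfl, rfl⟩ | ⟨rfl, rfl⟩ | ⟨rfl, rfl⟩ :
      i = 4 ∧ j = 0 ∨ i = 3 ∧ j = 1 ∨ i = 2 ∧ j = 2 ∨ i = 1 ∧ j = 3 ∨ i = 0 ∧ j = 4 := by omega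
    · exact cupCapSize_one hℓ (by norm_num) (by norm_num)
    · exact cupCapSize_two_four hℓ
    · have := h23.join hℓ h32
      rwa [show 1 + (ℓ - 1) + (ℓ - 1 + 1) = 2 * ℓ by omega] at this
    · exact cupCapSize_four_two hℓ
    · exact cupCapSize_one hℓ (by norm_num) (by norm_num)
  | succ k ih =>
    rintro (_ | i) (_ | j) hij
    · omega
    · rw [show j + 1 = 4 + (k + 1) by omega, joinSize_last]
      exact cupCapSize_one hℓ (by omega) (by norm_num)
    · rw [joinSize_zero_right]
      exact cupCapSize_one hℓ (by norm_num) (by omega)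
    · exact (ih (i + 1) j (by omega)).join hℓ (ih i (j + 1) (by omega))

open scoped Classical in
/-- Joining the sets of one row of sizes yields no convex polygon with `6 + k` vertices. -/
theorem exists_join_row {ℓ : ℕ} (hℓ : 3 ≤ ℓ) (k j : ℕ) (hj : j ≤ 4 + k) :
    ∃ P : Finset Plane, P.card = ∑ i ∈ Finset.range (j + 1), joinSize ℓ k i ∧ DistinctX P ∧
      TripleLE (· = 0) (ℓ - 1) P ∧ TripleLE (· < 0) (j + 1) P ∧ ConvexLE (5 + k) P := by
  induction j with
  | zero =>
    obtain ⟨P, hc, hP⟩ := cupCapSize_one (a := 1) (b := 1) hℓ le_rfl le_rfl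
    refine ⟨P, by simp [hc, joinSize_zero_right], hP.distinctX, hP.collinear, hP.cap, ?_⟩
    intro S hS _
    have := Finset.card_le_card hS
    omega
  | succ j ih =>
    obtain ⟨Y, hYc, hY, hYcol, hYcap, hYconv⟩ := ih (by omega)
    obtain ⟨X, hXc, hX⟩ := cupCapSize_joinSize hℓ k (3 + k - j) (j + 1) (by omega)
    obtain ⟨v, hv⟩ := exists_rightBelow_shift Y X
    have hXx := hX.distinctX.shift v
    have hXcap := hX.cap.shift v
    have hXcup := hX.cup.shift v
    refine ⟨Y ∪ planeShift v X, ?_, hY.union hXx hv.lt, ?_, ?_, ?_⟩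
    · rw [card_union_of_lt hv.lt, card_shift, hYc, hXc, ← Finset.sum_range_succ]
    · exact .union_of_left_right (by omega) hYcol (hX.collinear.shift v) hY
        hXx hv.lt (fun y hy z hz x hx h => (hv.neg y hy z hz x hx h).ne)
        fun y hy x hx z hz h => (hv.pos y hy x hx z hz h).ne'
    · exact .union_of_right hYcap hXcap hXx hv.lt
        fun y hy x hx z hz h => (hv.pos y hy x hx z hz h).le.not_gt
    · refine hYconv.union hv (fun S hS hconv => ?_) hYcap hXcup (by omega)
      rcases S.eq_empty_or_nonempty with rfl | hne
      -- A set inside `X` has fewer than `(j + 2) + (4 + k - j) = 6 + k` points, its cap and cup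
      -- sharing one.
      · simp
      · have := hconv.card_lt hS hne hXcap hXcup
        omega

theorem exists_of_six_le {ℓ : ℕ} (hℓ : 3 ≤ ℓ) (k : ℕ) :
    ∃ P : Finset Plane, P.card = (6 * ℓ - 2) * 2 ^ k ∧ ¬ HasCollinear ℓ P ∧
      ¬ HasConvexPosition (6 + k) P := by
  obtain ⟨P, hc, -, hcol, -, hconv⟩ := exists_join_row hℓ k (4 + k) le_rfl
  refine ⟨P, ?_, not_hasCollinear (by omega) hcol, not_hasConvexPosition (by omega) ?_⟩
  · rw [hc, ← sum_joinSize hℓ, show 4 + k + 1 = 5 + k by omega]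
  · rwa [show 6 + k - 1 = 5 + k by omega]

/-! ### The case `n = 3` -/

/-- A collinear set: `ℓ - 1` points without three in convex position. -/
theorem exists_of_three {ℓ : ℕ} (hℓ : 3 ≤ ℓ) :
    ∃ P : Finset Plane, P.card = ℓ - 1 ∧ ¬ HasCollinear ℓ P ∧ ¬ HasConvexPosition 3 P := by
  have hI : (∀ i ∈ Finset.Ico (1 : ℤ) ℓ, 0 < i) ∨ ∀ i ∈ Finset.Ico (1 : ℤ) ℓ, i < 0 :=
    Or.inl fun i hi => by rw [Finset.mem_Ico] at hi; omega
  have hc : (wedge 1 (Finset.Ico (1 : ℤ) ℓ)).card = ℓ - 1 := by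
    rw [card_wedge, Int.card_Ico]
    omega
  refine ⟨_, hc, not_hasCollinear (by omega) (tripleLE_card hc.le),
    not_hasConvexPosition (by norm_num) fun S hS hconv =>
      card_le_two_of_forall_triple ((distinctX_wedge _ _).mono hS) fun a ha b hb c hc hab hbc => ?_⟩
  have h := orient_wedge_eq_zero hI a (hS ha) b (hS hb) c (hS hc)
  exact hconv a ha c hc a ha c hc b hb hab hbc hab hbc h.ge h.le

/-! ### The case `n = 4` -/

/-- The orientation of three points with integer coordinates. -/
def intOrient {m : ℕ} (x y : Fin m → ℤ) (a b c : Fin m) : ℤ :=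
  (x b - x a) * (y c - y a) - (y b - y a) * (x c - x a)

/-- The points with integer coordinates `x i`, `y i`. -/
noncomputable def intPoint {m : ℕ} (x y : Fin m → ℤ) (i : Fin m) : Plane :=
  !₂[(x i : ℝ), (y i : ℝ)]

theorem orient_intPoint {m : ℕ} (x y : Fin m → ℤ) (a b c : Fin m) :
    orient (intPoint x y a) (intPoint x y b) (intPoint x y c) = (intOrient x y a b c : ℝ) := by
  simp [orient, intPoint, intOrient]

open scoped Classical in
-- Only the two middle points of a quadruple can be sandwiched; `hconv` says that one of them is,
-- and both hypotheses are decidable for concrete coordinates.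
theorem exists_of_intPoint {m ℓ : ℕ} (x y : Fin m → ℤ) (hx : StrictMono x) (hℓ : 0 < ℓ)
    (hcol : ∀ c : Fin ℓ → Fin m, StrictMono c →
      ∃ i j k, i < j ∧ j < k ∧ intOrient x y (c i) (c j) (c k) ≠ 0)
    (hconv : ∀ a b c d : Fin m, a < b → b < c → c < d →
      (0 ≤ intOrient x y a b c ∨ 0 ≤ intOrient x y a b d) ∧
        (intOrient x y a b c ≤ 0 ∨ intOrient x y a b d ≤ 0) ∨
      (0 ≤ intOrient x y a c d ∨ 0 ≤ intOrient x y b c d) ∧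
        (intOrient x y a c d ≤ 0 ∨ intOrient x y b c d ≤ 0)) :
    ∃ P : Finset Plane, P.card = m ∧ ¬ HasCollinear ℓ P ∧ ¬ HasConvexPosition 4 P := by
  have hlt : ∀ a b, intPoint x y a 0 < intPoint x y b 0 ↔ a < b := fun a b => by
    simp [intPoint, hx.lt_iff_lt]
  have hinj : Function.Injective (intPoint x y) := fun a b hab => by
    by_contra hne
    rcases lt_or_gt_of_ne hne with h | h <;> rw [← hlt, hab] at h <;> exact lt_irrefl _ h
  have hP : DistinctX (Finset.univ.image (intPoint x y)) := by
    intro p hp q hq hpq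
    obtain ⟨a, -, rfl⟩ := Finset.mem_image.1 (Finset.mem_coe.1 hp)
    obtain ⟨b, -, rfl⟩ := Finset.mem_image.1 (Finset.mem_coe.1 hq)
    rcases lt_trichotomy a b with h | h | h
    · exact absurd hpq ((hlt a b).2 h).ne
    · rw [h]
    · exact absurd hpq ((hlt b a).2 h).ne'
  have hsort : ∀ {k : ℕ} {S : Finset Plane}, S ⊆ Finset.univ.image (intPoint x y) → k ≤ S.card →
      ∃ c : Fin k → Fin m, StrictMono c ∧ ∀ i, intPoint x y (c i) ∈ S := by
    intro k S hS hk
    obtain ⟨s, hs, hmono⟩ := exists_sorted (hP.mono hS) hk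
    choose c _ hc using fun i => Finset.mem_image.1 (hS (hs i))
    exact ⟨c, fun i j hij => (hlt _ _).1 (by simpa only [hc] using hmono hij),
      fun i => by rw [hc]; exact hs i⟩
  refine ⟨Finset.univ.image (intPoint x y), ?_, not_hasCollinear hℓ fun S hS hT => ?_,
    not_hasConvexPosition (by norm_num) fun S hS hT => ?_⟩
  · rw [Finset.card_image_of_injective _ hinj, Finset.card_univ, Fintype.card_fin]
  · by_contra! hcard
    obtain ⟨c, hc, hcS⟩ := hsort hS (k := ℓ) (by omega)
    obtain ⟨i, j, k, hij, hjk, hne⟩ := hcol c hc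
    refine hne ?_
    have := hT _ (hcS i) _ (hcS j) _ (hcS k) ((hlt _ _).2 (hc hij)) ((hlt _ _).2 (hc hjk))
    rw [orient_intPoint] at this
    exact_mod_cast this
  · by_contra! hcard
    obtain ⟨c, hc, hcS⟩ := hsort hS hcard
    have key : ∀ u q w v z : Fin 4, u < q → q < w → v < q → q < z →
        0 ≤ intOrient x y (c u) (c q) (c w) → intOrient x y (c v) (c q) (c z) ≤ 0 → False := by
      intro u q w v z h₁ h₂ h₃ h₄ hu hv
      refine hT _ (hcS u) _ (hcS w) _ (hcS v) _ (hcS z) _ (hcS q) ((hlt _ _).2 (hc h₁))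
        ((hlt _ _).2 (hc h₂)) ((hlt _ _).2 (hc h₃)) ((hlt _ _).2 (hc h₄)) ?_ ?_ <;>
        rw [orient_intPoint]
      · exact_mod_cast hu
      · exact_mod_cast hv
    rcases hconv (c 0) (c 1) (c 2) (c 3) (hc (by decide)) (hc (by decide)) (hc (by decide)) with
      ⟨h₁ | h₁, h₂ | h₂⟩ | ⟨h₁ | h₁, h₂ | h₂⟩
    · exact key 0 1 2 0 2 (by decide) (by decide) (by decide) (by decide) h₁ h₂
    · exact key 0 1 2 0 3 (by decide) (by decide) (by decide) (by decide) h₁ h₂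
    · exact key 0 1 3 0 2 (by decide) (by decide) (by decide) (by decide) h₁ h₂
    · exact key 0 1 3 0 3 (by decide) (by decide) (by decide) (by decide) h₁ h₂
    · exact key 0 2 3 0 3 (by decide) (by decide) (by decide) (by decide) h₁ h₂
    · exact key 0 2 3 1 3 (by decide) (by decide) (by decide) (by decide) h₁ h₂
    · exact key 1 2 3 0 3 (by decide) (by decide) (by decide) (by decide) h₁ h₂
    · exact key 1 2 3 1 3 (by decide) (by decide) (by decide) (by decide) h₁ h₂

theorem exists_of_three_four :
    ∃ P : Finset Plane, P.card = 4 ∧ ¬ HasCollinear 3 P ∧ ¬ HasConvexPosition 4 P := by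
  refine exists_of_intPoint ![-3, 0, 2, 5] ![-1, 0, 6, -1] ?_ (by norm_num) ?_ (by decide)
  · decide
  · intro c hc
    refine ⟨0, 1, 2, by decide, by decide, ?_⟩
    have key : ∀ a b c : Fin 4, a < b → b < c →
      intOrient ![-3, 0, 2, 5] ![-1, 0, 6, -1] a b c ≠ 0 := by decide
    exact key _ _ _ (hc (by decide)) (hc (by decide))

/-- Two nested triangles, the sides of the inner one pointing at the vertices of the outer. -/
theorem exists_of_four_four :
    ∃ P : Finset Plane, P.card = 6 ∧ ¬ HasCollinear 4 P ∧ ¬ HasConvexPosition 4 P := by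
  refine exists_of_intPoint ![-3, 0, 1, 2, 3, 5] ![-1, 0, 3, 6, 1, -1] ?_ (by norm_num) ?_
    (by decide)
  · decide
  · intro c hc
    have key : ∀ a b c d : Fin 6, a < b → b < c → c < d →
      intOrient ![-3, 0, 1, 2, 3, 5] ![-1, 0, 3, 6, 1, -1] a b c ≠ 0 ∨
      intOrient ![-3, 0, 1, 2, 3, 5] ![-1, 0, 3, 6, 1, -1] a b d ≠ 0 := by decide
    rcases key _ _ _ _ (hc (show (0 : Fin 4) < 1 by decide)) (hc (show (1 : Fin 4) < 2 by decide))
      (hc (show (2 : Fin 4) < 3 by decide)) with h | h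
    · exact ⟨0, 1, 2, by decide, by decide, h⟩
    · exact ⟨0, 1, 3, by decide, by decide, h⟩

/-! ### The case `n = 5` -/

/-- The point with parameter `t` on the `c`-th of three segments and two points, listed from left
to right. -/
noncomputable def pentaPoint (c : Fin 5) (t : ℝ) : Plane :=
  ![!₂[3 * t, t], !₂[4, 5], !₂[6 + t, 4], !₂[8 + 4 * t, 1 - t], !₂[14, 5]] c

/-- The orientation of three points on the segments `a`, `b`, `c`, read from left to right. -/
def pentaSign (a b c : Fin 5) : ℤ :=
  if a = b ∧ b = c then 0
  else if (a, b, c) ∈ [(0, 0, 3), (0, 1, 2), (0, 1, 3), (0, 1, 4), (0, 2, 2), (0, 2, 3), (0, 2, 4),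
    (0, 3, 3), (1, 2, 3), (2, 2, 3)] then -1 else 1

theorem pentaPoint_lt {a b : Fin 5} {s t : ℝ} (hs : 0 ≤ s ∧ s ≤ 1) (ht : 0 ≤ t ∧ t ≤ 1)
    (h : a < b) : pentaPoint a s 0 < pentaPoint b t 0 := by
  obtain ⟨hs0, hs1⟩ := hs
  obtain ⟨ht0, ht1⟩ := ht
  fin_cases a <;> fin_cases b <;> first | exact absurd h (by decide) | skip
  all_goals
    simp [pentaPoint]
    try linarith

theorem pentaPoint_single {a : Fin 5} (ha : a = 1 ∨ a = 4) (s t : ℝ) :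
    pentaPoint a s = pentaPoint a t := by
  rcases ha with rfl | rfl <;> simp [pentaPoint]

theorem pentaPoint_lt_iff {a : Fin 5} (ha : ¬ (a = 1 ∨ a = 4)) {s t : ℝ} :
    pentaPoint a s 0 < pentaPoint a t 0 ↔ s < t := by
  fin_cases a <;> simp [pentaPoint] at ha ⊢

theorem orient_pentaPoint_self (a : Fin 5) (r s t : ℝ) :
    orient (pentaPoint a r) (pentaPoint a s) (pentaPoint a t) = 0 := by
  fin_cases a <;> simp [pentaPoint, orient] <;> ring

/-- The orientation is affine in each parameter separately, so products of the bounds on the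
parameters suffice to certify its sign. -/
theorem orient_pentaPoint {a b c : Fin 5} {r s t : ℝ} (hr : 0 ≤ r ∧ r ≤ 1) (hs : 0 ≤ s ∧ s ≤ 1)
    (ht : 0 ≤ t ∧ t ≤ 1) (hab : pentaPoint a r 0 < pentaPoint b s 0)
    (hbc : pentaPoint b s 0 < pentaPoint c t 0) (hab' : a ≤ b) (hbc' : b ≤ c)
    (h : ¬ (a = b ∧ b = c)) :
    0 < pentaSign a b c * orient (pentaPoint a r) (pentaPoint b s) (pentaPoint c t) := by
  obtain ⟨hr0, hr1⟩ := hr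
  obtain ⟨hs0, hs1⟩ := hs
  obtain ⟨ht0, ht1⟩ := ht
  fin_cases a <;> fin_cases b <;> first | exact absurd hab' (by decide) | skip
  all_goals fin_cases c <;> first | exact absurd hbc' (by decide) | exact absurd ⟨rfl, rfl⟩ h | skip
  all_goals simp [pentaPoint] at hab hbc
  all_goals simp [pentaPoint, pentaSign, orient]
  all_goals
    nlinarith [mul_nonneg hr0 hs0, mul_nonneg hr0 ht0, mul_nonneg hs0 ht0,
        mul_nonneg hr0 (sub_nonneg.2 hs1), mul_nonneg hr0 (sub_nonneg.2 ht1),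
        mul_nonneg hs0 (sub_nonneg.2 ht1)]

/-- `a` and `b` can be the segments of consecutive points. -/
abbrev PentaStep (a b : Fin 5) : Prop := a ≤ b ∧ (a = b → ¬ (a = 1 ∨ a = 4))

/-- Some point among points on the segments `s 0, …, s 4` is sandwiched. -/
def PentaSandwich (s : Fin 5 → Fin 5) : Prop :=
  ∃ q : Fin 5, (∃ u, u < q ∧ ∃ w, q < w ∧ 0 ≤ pentaSign (s u) (s q) (s w)) ∧
    ∃ v, v < q ∧ ∃ z, q < z ∧ pentaSign (s v) (s q) (s z) ≤ 0

instance (s : Fin 5 → Fin 5) : Decidable (PentaSandwich s) := by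
  unfold PentaSandwich
  infer_instance

set_option maxRecDepth 100000 in
theorem pentaSandwich : ∀ a b : Fin 5, PentaStep a b → ∀ c, PentaStep b c → ∀ d, PentaStep c d →
    ∀ e, PentaStep d e → PentaSandwich ![a, b, c, d, e] := by
  decide

open scoped Classical in
theorem exists_of_five {ℓ : ℕ} (hℓ : 3 ≤ ℓ) :
    ∃ P : Finset Plane, P.card = 3 * ℓ - 1 ∧ ¬ HasCollinear ℓ P ∧ ¬ HasConvexPosition 5 P := by
  let m : Fin 5 → ℕ := fun c => if c = 1 ∨ c = 4 then 1 else ℓ - 1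
  let par : ℕ → ℝ := fun n => n / ℓ
  let D : Finset (Σ _ : Fin 5, ℕ) := Finset.univ.sigma fun c => Finset.range (m c)
  let f : (Σ _ : Fin 5, ℕ) → Plane := fun p => pentaPoint p.1 (par p.2)
  have hℓ0 : (0 : ℝ) < ℓ := by exact_mod_cast (show 0 < ℓ by omega)
  have hD : ∀ p ∈ D, p.2 < m p.1 := fun p hp =>
    Finset.mem_range.1 (Finset.mem_sigma.1 hp).2
  have hm : ∀ c, m c ≤ ℓ - 1 := fun c => by
    simp only [m]
    split_ifs <;> omega
  have hpar : ∀ p ∈ D, 0 ≤ par p.2 ∧ par p.2 ≤ 1 := fun p hp => by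
    refine ⟨by positivity, (div_le_one hℓ0).2 ?_⟩
    have := hD p hp
    have := hm p.1
    exact_mod_cast (show p.2 ≤ ℓ by omega)
  have hpar_lt : ∀ {i j : ℕ}, par i < par j ↔ i < j := fun {i j} => by
    simp only [par, div_lt_div_iff_of_pos_right hℓ0, Nat.cast_lt]
  have hle : ∀ p ∈ D, ∀ q ∈ D, f p 0 < f q 0 → p.1 ≤ q.1 := fun p hp q hq h => by
    by_contra! hlt
    exact lt_asymm h (pentaPoint_lt (hpar q hq) (hpar p hp) hlt)
  have hinj : ∀ p ∈ D, ∀ q ∈ D, f p 0 = f q 0 → p = q := by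
    rintro ⟨c, i⟩ hp ⟨d, j⟩ hq h
    rcases lt_trichotomy c d with hcd | rfl | hcd
    · exact absurd h (pentaPoint_lt (hpar _ hp) (hpar _ hq) hcd).ne
    · have hi := hD _ hp
      have hj := hD _ hq
      by_cases hc : c = 1 ∨ c = 4
      · simp only [m, hc, if_true] at hi hj
        rw [show i = j by omega]
      · rcases lt_trichotomy i j with hij | rfl | hij
        · exact absurd h ((pentaPoint_lt_iff hc).2 (hpar_lt.2 hij)).ne
        · rfl
        · exact absurd h ((pentaPoint_lt_iff hc).2 (hpar_lt.2 hij)).ne'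
    · exact absurd h (pentaPoint_lt (hpar _ hq) (hpar _ hp) hcd).ne'
  have hP : DistinctX (D.image f) := by
    intro a ha b hb hab
    obtain ⟨p, hp, rfl⟩ := Finset.mem_image.1 (Finset.mem_coe.1 ha)
    obtain ⟨q, hq, rfl⟩ := Finset.mem_image.1 (Finset.mem_coe.1 hb)
    rw [hinj p hp q hq hab]
  have hsort : ∀ {k : ℕ} {S : Finset Plane}, S ⊆ D.image f → k ≤ S.card →
      ∃ p : Fin k → Σ _ : Fin 5, ℕ, (∀ i, p i ∈ D) ∧ (∀ i, f (p i) ∈ S) ∧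
        StrictMono fun i => f (p i) 0 := by
    intro k S hS hk
    obtain ⟨s, hs, hmono⟩ := exists_sorted (hP.mono hS) hk
    choose p hpD hps using fun i => Finset.mem_image.1 (hS (hs i))
    refine ⟨p, hpD, fun i => by rw [hps]; exact hs i, by simpa only [hps] using hmono⟩
  have hsign : ∀ p ∈ D, ∀ q ∈ D, ∀ r ∈ D, f p 0 < f q 0 → f q 0 < f r 0 →
      ¬ (p.1 = q.1 ∧ q.1 = r.1) → 0 < pentaSign p.1 q.1 r.1 * orient (f p) (f q) (f r) :=
    fun p hp q hq r hr hpq hqr h => orient_pentaPoint (hpar p hp) (hpar q hq) (hpar r hr) hpq hqr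
      (hle p hp q hq hpq) (hle q hq r hr hqr) h
  have hself : ∀ p q r, p.1 = q.1 ∧ q.1 = r.1 → orient (f p) (f q) (f r) = 0 := by
    rintro ⟨c, i⟩ ⟨_, j⟩ ⟨_, k⟩ ⟨rfl, rfl⟩
    exact orient_pentaPoint_self _ _ _ _
  have hsingle : ∀ p q, f p 0 < f q 0 → p.1 = q.1 → ¬ (p.1 = 1 ∨ p.1 = 4) := by
    rintro ⟨c, i⟩ ⟨_, j⟩ h rfl hc
    exact h.ne (congrArg (fun p : Plane => p 0) (pentaPoint_single hc _ _))
  refine ⟨D.image f, ?_, not_hasCollinear (by omega) fun S hS hT => ?_,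
    not_hasConvexPosition (by norm_num) fun S hS hT => ?_⟩
  · rw [Finset.card_image_of_injOn fun p hp q hq h => hinj p hp q hq (by rw [h]),
      Finset.card_sigma]
    simp [Fin.sum_univ_five, m]
    omega
  · by_contra! hcard
    obtain ⟨p, hpD, hpS, hmono⟩ := hsort hS (k := ℓ) (by omega)
    -- Triples not on one piece have nonzero orientation, so the `ℓ` points would share a segment
    -- that carries only `ℓ - 1`.
    have htriple : ∀ i j k, i < j → j < k → (p i).1 = (p j).1 ∧ (p j).1 = (p k).1 := by
      intro i j k hij hjk
      by_contra hne
      have := hsign _ (hpD i) _ (hpD j) _ (hpD k) (hmono hij) (hmono hjk) hne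
      rw [hT _ (hpS i) _ (hpS j) _ (hpS k) (hmono hij) (hmono hjk), mul_zero] at this
      exact lt_irrefl _ this
    have hcls : Monotone fun i => (p i).1 := fun i j hij => by
      rcases hij.eq_or_lt with rfl | hij
      · rfl
      · exact hle _ (hpD i) _ (hpD j) (hmono hij)
    let i₀ : Fin ℓ := ⟨0, by omega⟩
    let i₁ : Fin ℓ := ⟨1, by omega⟩
    let i₂ : Fin ℓ := ⟨ℓ - 1, by omega⟩
    have h01 : i₀ < i₁ := Fin.mk_lt_mk.2 (by omega)
    have h12 : i₁ < i₂ := Fin.mk_lt_mk.2 (by omega)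
    obtain ⟨h₁, h₂⟩ := htriple i₀ i₁ i₂ h01 h12
    have hconst : ∀ i, (p i).1 = (p i₀).1 := fun i =>
      le_antisymm ((hcls (Fin.le_def.2 (show i.1 ≤ ℓ - 1 by omega))).trans (h₁.trans h₂).ge)
        (hcls (Fin.le_def.2 (Nat.zero_le _)))
    have hns := hsingle _ _ (hmono h01) h₁
    have hn : StrictMono fun i => (p i).2 := by
      intro i j hij
      have h := hmono hij
      simp only [f, hconst] at h
      exact hpar_lt.1 ((pentaPoint_lt_iff hns).1 h)
    have hlt : ∀ i, (p i).2 < ℓ - 1 := fun i => (hD _ (hpD i)).trans_le (hm _)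
    have := Fintype.card_le_of_injective (fun i => (⟨(p i).2, hlt i⟩ : Fin (ℓ - 1)))
      fun i j hij => hn.injective (Fin.mk.inj_iff.1 hij)
    simp only [Fintype.card_fin] at this
    omega
  · by_contra! hcard
    obtain ⟨p, hpD, hpS, hmono⟩ := hsort hS (k := 5) (by omega)
    have hstep : ∀ i j, i < j → PentaStep (p i).1 (p j).1 := fun i j hij =>
      ⟨hle _ (hpD i) _ (hpD j) (hmono hij), hsingle _ _ (hmono hij)⟩
    have hsand := pentaSandwich _ _ (hstep 0 1 (by decide)) _ (hstep 1 2 (by decide)) _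
      (hstep 2 3 (by decide)) _ (hstep 3 4 (by decide))
    rw [show ![(p 0).1, (p 1).1, (p 2).1, (p 3).1, (p 4).1] = fun i => (p i).1 from
      funext fun i => by fin_cases i <;> rfl] at hsand
    obtain ⟨q, ⟨u, huq, w, hqw, hup⟩, v, hvq, z, hqz, hlow⟩ := hsand
    refine hT _ (hpS u) _ (hpS w) _ (hpS v) _ (hpS z) _ (hpS q) (hmono huq) (hmono hqw)
      (hmono hvq) (hmono hqz) ?_ ?_
    · by_cases h : (p u).1 = (p q).1 ∧ (p q).1 = (p w).1
      · exact (hself _ _ _ h).ge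
      · have := hsign _ (hpD u) _ (hpD q) _ (hpD w) (hmono huq) (hmono hqw) h
        have hup' : (0 : ℝ) ≤ pentaSign (p u).1 (p q).1 (p w).1 := by exact_mod_cast hup
        by_contra! hneg
        exact this.not_ge (mul_nonpos_of_nonneg_of_nonpos hup' hneg.le)
    · by_cases h : (p v).1 = (p q).1 ∧ (p q).1 = (p z).1
      · exact (hself _ _ _ h).le
      · have := hsign _ (hpD v) _ (hpD q) _ (hpD z) (hmono hvq) (hmono hqz) h
        have hlow' : (pentaSign (p v).1 (p q).1 (p z).1 : ℝ) ≤ 0 := by exact_mod_cast hlow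
        by_contra! hpos
        exact this.not_ge (mul_nonpos_of_nonpos_of_nonneg hlow' hpos.le)

/-! ### Conclusion -/

theorem ofReal_le_ES {ℓ n : ℕ} {r : ℝ} {M : ℕ} (h : ∃ P : Finset Plane, P.card = M ∧
    ¬ HasCollinear ℓ P ∧ ¬ HasConvexPosition n P) (hr : r ≤ M) :
    ENNReal.ofReal (r + 1) ≤ (ES ℓ n : ℝ≥0∞) := by
  obtain ⟨P, rfl, hcol, hconv⟩ := h
  calc ENNReal.ofReal (r + 1) ≤ ENNReal.ofReal ((P.card + 1 : ℕ) : ℝ) :=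
        ENNReal.ofReal_le_ofReal (by push_cast; linarith)
    _ = (((P.card + 1 : ℕ) : ℕ∞) : ℝ≥0∞) := by
        rw [ENNReal.ofReal_natCast]
        rfl
    _ ≤ (ES ℓ n : ℝ≥0∞) := by exact_mod_cast lt_ES P hcol hconv

theorem theorem2 (ℓ n : ℕ) (hℓ : 3 ≤ ℓ) (hn : 3 ≤ n) (h4 : n = 4 → ℓ ≤ 4) :
    ENNReal.ofReal ((3 * (ℓ : ℝ) - 1) * (2 : ℝ) ^ ((n : ℤ) - 5) + 1) ≤ (ES ℓ n : ℝ≥0∞) := by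
  have hℓ' : (3 : ℝ) ≤ ℓ := by exact_mod_cast hℓ
  obtain rfl | rfl | rfl | ⟨k, rfl⟩ : n = 3 ∨ n = 4 ∨ n = 5 ∨ ∃ k, n = 6 + k := by
    rcases le_or_gt 6 n with h | h
    · exact Or.inr (Or.inr (Or.inr (Nat.exists_eq_add_of_le h)))
    · omega
  -- Here `(3ℓ - 1)/4 ≤ ℓ - 1` is equivalent to `ℓ ≥ 3`.
  · refine ofReal_le_ES (exists_of_three hℓ) ?_
    rw [Nat.cast_sub (by omega)]
    norm_num
    linarith
  · obtain rfl | rfl : ℓ = 3 ∨ ℓ = 4 := by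
      have := h4 rfl
      omega
    -- The value `(3ℓ - 1)/2` is `4` for `ℓ = 3` and `11/2` for `ℓ = 4`.
    · exact ofReal_le_ES exists_of_three_four (by norm_num)
    · exact ofReal_le_ES exists_of_four_four (by norm_num)
  · refine ofReal_le_ES (exists_of_five hℓ) ?_
    rw [Nat.cast_sub (by omega)]
    norm_num
  · refine ofReal_le_ES (exists_of_six_le hℓ k) ?_
    rw [show ((6 + k : ℕ) : ℤ) - 5 = ((k + 1 : ℕ) : ℤ) by push_cast; ring, zpow_natCast]
    push_cast [Nat.cast_sub (show 2 ≤ 6 * ℓ by omega)]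
    rw [pow_succ]
    linarith
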